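/- Let $\mathcal O$ be a complete discrete valuation ring with fraction field $\mathcal K$, and let $A$ be a Gorenstein $\mathcal O$-order, that is, an $\mathcal O$-algebra which is free of finite rank as an $\mathcal O$-module and for which $\operatorname{Hom}_{\mathcal O}(A_A,\mathcal O)$ is a projective $A$-module. Modules are left modules; an $A$-lattice is an $A$-module that is free of finite rank over $\mathcal O$. Put $D=\operatorname{Hom}_{\mathcal O}(-,\mathcal O)$ and let $\nu=D\operatorname{Hom}_A(-,A)$ be the Nakayama functor. For $A$-lattices $X,Y$, let $\operatorname{Rad}\operatorname{Hom}_A(X,Y)$ be the set of $f\in\operatorname{Hom}_A(X,Y)$ such that $hfg\in\operatorname{Rad}\operatorname{End}_A(Z)$ for every indecomposable $A$-lattice $Z$ and all $g\in\operatorname{Hom}_A(Z,X)$, $h\in\operatorname{Hom}_A(Y,Z)$, where $\operatorname{Rad}\operatorname{End}_A(Z)$ is the Jacobson radical of the ring $\operatorname{End}_A(Z)$. A short exact sequence of $A$-lattices $0\to L\to E\xrightarrow{q}M\to 0$ is called almost split if $q$ does not split, $L$ and $M$ are indecomposable, and for every indecomposable $A$-lattice $X$ the image of $\operatorname{Hom}_A(X,q):\operatorname{Hom}_A(X,E)\to\operatorname{Hom}_A(X,M)$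 is exactly $\operatorname{Rad}\operatorname{Hom}_A(X,M)$. Let $M$ be an indecomposable non-projective $A$-lattice such that $M\otimes_{\mathcal O}\mathcal K$ is a projective $A\otimes_{\mathcal O}\mathcal K$-module. Let $p:P\to M$ be a projective cover and put $L=D\big(\operatorname{Coker}(\operatorname{Hom}_A(p,A):\operatorname{Hom}_A(M,A)\to\operatorname{Hom}_A(P,A))\big)$, so that there is an exact sequence of $A$-lattices $$0\to L\to\nu(P)\xrightarrow{\nu(p)}\nu(M)\to 0 .$$ Let $\varphi\in\operatorname{Hom}_A(M,\nu(M))$, and let $0\to L\to E\to M\to 0$ be the pullback of this sequence along $\varphi$, so $E=\{(x,m)\in\nu(P)\times M:\nu(p)(x)=\varphi(m)\}$. Then the following are equivalent. 1. The pullback $0\to L\to E\to M\to 0$ is an almost split sequence. 2. The following three conditions hold: (i) $\varphi$ does not factor through $\nu(p)$, i.e. there is no $\psi\in\operatorname{Hom}_A(M,\nu(P))$ with $\nu(p)\psi=\varphi$; (ii) $L$ is an indecomposable $A$-lattice; (iii) for every $f\in\operatorname{Rad}\operatorname{End}_A(M)$, the map $\varphi f$ factors through $\nu(p)$. -/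

import Mathlib

universe u v

open scoped TensorProduct

noncomputable section

namespace LatticeAR

section Modules

/-- A nonzero module which is not the internal direct sum of two nonzero submodules. -/
def IsIndecomposable (A : Type*) [Ring A] (X : Type*) [AddCommGroup X] [Module A X] : Prop :=
  Nontrivial X ∧ ∀ Y Z : Submodule A X, IsCompl Y Z → Y = ⊥ ∨ Z = ⊥

/-- A projective cover: a surjection from a projective module with superfluous kernel. -/
structure IsProjectiveCover {A : Type*} [Ring A] {P M : Type*} [AddCommGroup P] [Module A P]
    [AddCommGroup M] [Module A M] (p : P →ₗ[A] M) : Prop where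
  projective : Module.Projective A P
  surjective : Function.Surjective p
  superfluous : ∀ N : Submodule A P, N ⊔ LinearMap.ker p = ⊤ → N = ⊤

/-- An `A`-lattice: an `A`-module which is free of finite rank over `O`. -/
structure IsLattice (O A X : Type*) [CommRing O] [Ring A] [Algebra O A] [AddCommGroup X]
    [Module O X] [Module A X] [IsScalarTower O A X] : Prop where
  finite : Module.Finite O X
  free : Module.Free O X

/-- The action of `A ⊗ K` on `X ⊗ K`, given by `(a ⊗ c) • (x ⊗ d) = (a • x) ⊗ (c * d)`. -/
def scalarExtensionAction (O K A X : Type*) [CommRing O] [Field K] [Algebra O K] [Ring A]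
    [Algebra O A] [AddCommGroup X] [Module O X] [Module A X] [IsScalarTower O A X] :
    A ⊗[O] K →ₐ[O] Module.End O (X ⊗[O] K) :=
  (Module.endTensorEndAlgHom (R := O) (S := O) (A := O) (M := X) (N := K)).comp
    (Algebra.TensorProduct.map (Algebra.lsmul O O X) (Algebra.lsmul O O K))

theorem scalarExtensionAction_tmul (O K A X : Type*) [CommRing O] [Field K] [Algebra O K]
    [Ring A] [Algebra O A] [AddCommGroup X] [Module O X] [Module A X] [IsScalarTower O A X]
    (a : A) (c : K) (x : X) (d : K) :
    scalarExtensionAction O K A X (a ⊗ₜ c) (x ⊗ₜ d) = (a • x) ⊗ₜ[O] (c * d) := rfl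

/-- The `A ⊗ K`-module structure on `X ⊗ K`. -/
abbrev scalarExtensionModule (O K A X : Type*) [CommRing O] [Field K] [Algebra O K] [Ring A]
    [Algebra O A] [AddCommGroup X] [Module O X] [Module A X] [IsScalarTower O A X] :
    Module (A ⊗[O] K) (X ⊗[O] K) :=
  Module.compHom (X ⊗[O] K) (scalarExtensionAction O K A X).toRingHom

/-- `X ⊗ K` is a projective `A ⊗ K`-module. -/
def IsGenericallyProjective (O K A X : Type*) [CommRing O] [Field K] [Algebra O K] [Ring A]
    [Algebra O A] [AddCommGroup X] [Module O X] [Module A X] [IsScalarTower O A X] : Prop :=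
  letI : Module (A ⊗[O] K) (X ⊗[O] K) := scalarExtensionModule O K A X
  Module.Projective (A ⊗[O] K) (X ⊗[O] K)

end Modules

section Dual

/-- The dual `D N = Hom_O(N, O)`. -/
def LatticeDual (O N : Type*) [CommRing O] [AddCommGroup N] [Module O N] : Type _ :=
  N →ₗ[O] O

instance (O N : Type*) [CommRing O] [AddCommGroup N] [Module O N] :
    AddCommGroup (LatticeDual O N) :=
  inferInstanceAs (AddCommGroup (N →ₗ[O] O))

instance (O N : Type*) [CommRing O] [AddCommGroup N] [Module O N] :
    Module O (LatticeDual O N) :=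
  inferInstanceAs (Module O (N →ₗ[O] O))

instance (O N : Type*) [CommRing O] [AddCommGroup N] [Module O N] :
    FunLike (LatticeDual O N) N O :=
  inferInstanceAs (FunLike (N →ₗ[O] O) N O)

variable (O A : Type*) [CommRing O] [Ring A] [Algebra O A]
variable {N N' : Type*} [AddCommGroup N] [Module O N] [Module Aᵐᵒᵖ N] [IsScalarTower O Aᵐᵒᵖ N]
  [AddCommGroup N'] [Module O N'] [Module Aᵐᵒᵖ N'] [IsScalarTower O Aᵐᵒᵖ N']

/-- Right multiplication by `a` on a right `A`-module, as an `O`-linear map. -/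
def rightMul (a : A) : N →ₗ[O] N where
  toFun n := MulOpposite.op a • n
  map_add' := smul_add _
  map_smul' c n := smul_comm (MulOpposite.op a) c n

/-- The dual of a right `A`-module is a left `A`-module through `(a • f) n = f (n a)`. -/
instance latticeDualModule : Module A (LatticeDual O N) where
  smul a f := LinearMap.comp (f : N →ₗ[O] O) (rightMul O A a)
  one_smul f := LinearMap.ext fun n => congrArg f (one_smul Aᵐᵒᵖ n)
  mul_smul a b f := LinearMap.ext fun n =>
    congrArg f (mul_smul (MulOpposite.op b) (MulOpposite.op a) n)
  smul_zero _ := rfl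
  smul_add _ _ _ := rfl
  add_smul a b f := LinearMap.ext fun n =>
    (congrArg f (add_smul (MulOpposite.op a) (MulOpposite.op b) n)).trans
      (LinearMap.map_add (f : N →ₗ[O] O) _ _)
  zero_smul f := LinearMap.ext fun n =>
    (congrArg f (zero_smul Aᵐᵒᵖ n)).trans (LinearMap.map_zero (f : N →ₗ[O] O))

theorem latticeDual_smul_apply (a : A) (f : LatticeDual O N) (n : N) :
    (a • f) n = f (MulOpposite.op a • n) := rfl

instance : IsScalarTower O A (LatticeDual O N) where
  smul_assoc c a f := LinearMap.ext fun n =>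
    (congrArg f (smul_assoc c (MulOpposite.op a) n)).trans
      (LinearMap.map_smul (f : N →ₗ[O] O) _ _)

/-- The `A`-linear map `D N' → D N` induced by a homomorphism `N → N'` of right modules. -/
def dualMap (g : N →ₗ[Aᵐᵒᵖ] N') : LatticeDual O N' →ₗ[A] LatticeDual O N where
  toFun f := LinearMap.comp (f : N' →ₗ[O] O) (g.restrictScalars O)
  map_add' _ _ := rfl
  map_smul' a f := LinearMap.ext fun n => congrArg f (g.map_smul (MulOpposite.op a) n).symm

/-- A Gorenstein order: an `O`-order `A` (an `O`-algebra which is free of finite rank over `O`)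
such that the dual `Hom_O(A, O)` of the right regular module is a projective left `A`-module. -/
structure IsGorensteinOrder : Prop where
  finite : Module.Finite O A
  free : Module.Free O A
  projective_dual : Module.Projective A (LatticeDual O A)

end Dual

section Nakayama

variable (O A : Type*) [CommRing O] [Ring A] [Algebra O A]
variable {P M : Type*} [AddCommGroup P] [Module A P] [AddCommGroup M] [Module A M]

/-- The map `Hom_A(p, A) : Hom_A(M, A) → Hom_A(P, A)` of right `A`-modules. -/
def homMap (p : P →ₗ[A] M) : (M →ₗ[A] A) →ₗ[Aᵐᵒᵖ] (P →ₗ[A] A) where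
  toFun g := g.comp p
  map_add' _ _ := rfl
  map_smul' _ _ := rfl

/-- The Nakayama functor on objects: `ν M = Hom_O(Hom_A(M, A), O)`. -/
abbrev Nakayama (M : Type*) [AddCommGroup M] [Module A M] : Type _ := LatticeDual O (M →ₗ[A] A)

/-- The Nakayama functor on morphisms. -/
def nakayamaMap (p : P →ₗ[A] M) : Nakayama O A P →ₗ[A] Nakayama O A M :=
  dualMap O A (homMap A p)

/-- The right module `Coker (Hom_A(p, A))`. -/
abbrev HomCoker (p : P →ₗ[A] M) : Type _ := (P →ₗ[A] A) ⧸ LinearMap.range (homMap A p)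

/-- The left module `L = D (Coker (Hom_A(p, A)))`. -/
abbrev Translate (p : P →ₗ[A] M) : Type _ := LatticeDual O (HomCoker A p)

/-- The map `L → ν P` dual to the projection `Hom_A(P, A) → Coker (Hom_A(p, A))`. -/
def translateIncl (p : P →ₗ[A] M) : Translate O A p →ₗ[A] Nakayama O A P :=
  dualMap O A (LinearMap.range (homMap A p)).mkQ

theorem nakayamaMap_translateIncl (p : P →ₗ[A] M) (l : Translate O A p) :
    nakayamaMap O A p (translateIncl O A p l) = 0 :=
  LinearMap.ext fun g =>
    (congrArg l ((Submodule.Quotient.mk_eq_zero _).2 ⟨g, rfl⟩)).trans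
      (LinearMap.map_zero (l : HomCoker A p →ₗ[O] O))

variable {A}

/-- The pullback `E` of `ν(p) : ν P → ν M` along `φ : M → ν M`. -/
def pullback (p : P →ₗ[A] M) (φ : M →ₗ[A] Nakayama O A M) : Submodule A (Nakayama O A P × M) :=
  LinearMap.eqLocus ((nakayamaMap O A p).comp (LinearMap.fst A (Nakayama O A P) M))
    (φ.comp (LinearMap.snd A (Nakayama O A P) M))

/-- The map `L → E` of the pullback sequence. -/
def pullbackIncl (p : P →ₗ[A] M) (φ : M →ₗ[A] Nakayama O A M) :
    Translate O A p →ₗ[A] pullback O p φ :=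
  LinearMap.codRestrict (pullback O p φ)
    ((LinearMap.inl A (Nakayama O A P) M).comp (translateIncl O A p))
    fun l => (nakayamaMap_translateIncl O A p l).trans (φ.map_zero).symm

/-- The map `E → M` of the pullback sequence. -/
def pullbackProj (p : P →ₗ[A] M) (φ : M →ₗ[A] Nakayama O A M) : pullback O p φ →ₗ[A] M :=
  (LinearMap.snd A (Nakayama O A P) M).comp (pullback O p φ).subtype

end Nakayama

section AlmostSplit

variable (O : Type u) [CommRing O] {A : Type u} [Ring A] [Algebra O A]

/-- `f` lies in `Rad Hom_A(M, N)`: for every indecomposable lattice `X` and all `g : X → M`,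
`h : N → X`, the composite `h f g` lies in the Jacobson radical of `End_A(X)`. -/
def IsRadicalHom {M N : Type u} [AddCommGroup M] [Module A M] [AddCommGroup N] [Module A N]
    (f : M →ₗ[A] N) : Prop :=
  ∀ (X : Type u) [AddCommGroup X] [Module O X] [Module A X] [IsScalarTower O A X],
    IsLattice O A X → IsIndecomposable A X →
      ∀ (g : X →ₗ[A] M) (h : N →ₗ[A] X), h ∘ₗ f ∘ₗ g ∈ Ring.jacobson (Module.End A X)

/-- `0 → L → E → M → 0` is an almost split sequence of `A`-lattices. -/
structure IsAlmostSplit {L E M : Type u} [AddCommGroup L] [Module O L] [Module A L]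
    [IsScalarTower O A L] [AddCommGroup E] [Module O E] [Module A E] [IsScalarTower O A E]
    [AddCommGroup M] [Module O M] [Module A M] [IsScalarTower O A M]
    (i : L →ₗ[A] E) (q : E →ₗ[A] M) : Prop where
  lattice_left : IsLattice O A L
  lattice_middle : IsLattice O A E
  lattice_right : IsLattice O A M
  injective : Function.Injective i
  exact : Function.Exact i q
  surjective : Function.Surjective q
  not_split : ¬ ∃ s : M →ₗ[A] E, q ∘ₗ s = LinearMap.id
  indecomposable_left : IsIndecomposable A L
  indecomposable_right : IsIndecomposable A M
  /-- For indecomposable `X`, composition with `q` maps `Hom_A(X, E)` onto `Rad Hom_A(X, M)`. -/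
  range_eq_radical : ∀ (X : Type u) [AddCommGroup X] [Module O X] [Module A X]
    [IsScalarTower O A X], IsLattice O A X → IsIndecomposable A X →
      ∀ f : X →ₗ[A] M, (∃ g : X →ₗ[A] E, q ∘ₗ g = f) ↔ IsRadicalHom O f

end AlmostSplit

end LatticeAR

end

/-! A map `f : X → M` lifts to the pullback exactly when `φ f` factors through `ν(p)`, so everything
rests on a numerical test for such factorizations. Generic projectivity, after clearing
denominators, gives `r ≠ 0`, forms `l i` and elements `x i` with `∑ l i m • x i = r • m`. For `θ : M
→ ν M` consider the trace `∑ θ (x i) (l i)`. If `θ` factors through `ν(p)`, then `r` divides it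
(`dvd_trace_of_factors`). Conversely `θ : X → ν M` factors as soon as `r` divides the traces of `θ
g` for all `g : M → X` (`exists_factorization_of_dvd_trace`).

The test involves only endomorphisms of `M`, so (iii) suffices for all `X`: if `f : X → M` is
radical, each `f g` lies in `Rad End(M)`, each `φ f g` factors, and hence `φ f` factors. In the
other direction, `End(M)` is local and the sequence does not split, so every endomorphism of `M`
through `E` is radical (`comp_mem_jacobson_of_not_split`), which makes every liftable `f` radical.
-/

namespace LatticeAR

/-! ### Local endomorphism rings by lifting idempotents -/

section LocalEndomorphismRing

/-- Completeness passes coordinatewise to `R^n`, then to its quotient `N` because completion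
preserves surjections. -/
theorem isPrecomplete_of_finite {R N : Type*} [CommRing R] [AddCommGroup N] [Module R N]
    (I : Ideal R) [IsPrecomplete I R] [Module.Finite R N] : IsPrecomplete I N := by
  obtain ⟨n, π, hπ⟩ := Module.Finite.exists_fin' R N
  rw [← AdicCompletion.of_surjective_iff]
  have h1 : Function.Surjective (AdicCompletion.of I (Fin n → R)) := by
    intro x
    choose y hy using fun j =>
      AdicCompletion.of_surjective I R (AdicCompletion.piEquivFin I n x j)
    refine ⟨y, (AdicCompletion.piEquivFin I n).injective (funext fun j => ?_)⟩
    rw [← hy, AdicCompletion.piEquivFin_apply]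
    rfl
  intro x
  obtain ⟨z, rfl⟩ := AdicCompletion.map_surjective I hπ x
  obtain ⟨y, rfl⟩ := h1 z
  exact ⟨π y, (AdicCompletion.map_of I π y).symm⟩

/-- A finite algebra without nontrivial idempotents over a complete Noetherian local ring is
local. -/
theorem isUnit_or_isUnit_one_sub_of_finite {R S : Type*} [CommRing R] [IsNoetherianRing R]
    [IsLocalRing R] [IsAdicComplete (IsLocalRing.maximalIdeal R) R] [CommRing S] [Algebra R S]
    [Module.Finite R S] (hS : ∀ e : S, e * e = e → e = 0 ∨ e = 1) (x : S) :
    IsUnit x ∨ IsUnit (1 - x) := by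
  set m := IsLocalRing.maximalIdeal R
  have : IsPrecomplete m S := isPrecomplete_of_finite m
  have : IsAdicComplete m S := ⟨⟩
  set J : Ideal S := m.map (algebraMap R S)
  have : IsAdicComplete J S := (IsAdicComplete.map_algebraMap_iff m S).2 ‹_›
  have hJ := IsAdicComplete.le_jacobson_bot J
  have hloc := isLocalHom_of_le_jacobson_bot J hJ
  have : IsArtinianRing (S ⧸ J) := by
    have : Module.Finite (R ⧸ m) (S ⧸ J) := Module.Finite.of_restrictScalars_finite R _ _
    let : Field (R ⧸ m) := Ideal.Quotient.field m
    have : IsArtinian (R ⧸ m) (S ⧸ J) := inferInstance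
    exact isArtinian_of_tower (R ⧸ m) this
  set q := Ideal.Quotient.mk J
  -- Powers of `x` stabilize in the Artinian quotient by `J`. The exponent is then raised by one to
  -- be nonzero, so that a unit power forces a unit base.
  obtain ⟨l, y, hy⟩ := IsArtinian.exists_pow_succ_smul_dvd (q x) (1 : S ⧸ J)
  obtain ⟨n, hn, hy'⟩ : ∃ n, n ≠ 0 ∧ q x ^ (n + 1) * y = q x ^ n := by
    refine ⟨l + 1, l.succ_ne_zero, ?_⟩
    rw [pow_succ', mul_assoc, pow_succ' _ l]
    exact congrArg (q x * ·) (by simpa [pow_succ'] using hy)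
  have hk : ∀ k, q x ^ (n + k) * y ^ k = q x ^ n := by
    intro k
    induction k with
    | zero => simp
    | succ k ih =>
      calc q x ^ (n + (k + 1)) * y ^ (k + 1)
          = (q x ^ (n + 1) * y) * (q x ^ k * y ^ k) := by ring
        _ = q x ^ (n + k) * y ^ k := by rw [hy']; ring
        _ = _ := ih
  -- `x^n y^n` is idempotent modulo `J`; Hensel's lemma for `X² - X` lifts it to `S`.
  obtain ⟨e₀, he₀⟩ := Ideal.Quotient.mk_surjective (q x ^ n * y ^ n)
  have hid : q e₀ * q e₀ = q e₀ := by
    change q e₀ = _ at he₀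
    calc q e₀ * q e₀ = (q x ^ (n + n) * y ^ n) * y ^ n := by rw [he₀]; ring
      _ = q e₀ := by rw [hk, he₀]
  obtain ⟨e, he, hee⟩ := HenselianRing.is_henselian (I := J)
    (Polynomial.X ^ 2 - Polynomial.X) (by monicity!) e₀
    (by
      rw [← Ideal.Quotient.eq_zero_iff_mem]
      simp only [Polynomial.eval_sub, Polynomial.eval_pow, Polynomial.eval_X, map_sub, map_pow]
      rw [pow_two]
      exact sub_eq_zero.2 hid)
    (by
      -- The derivative `2e - 1` at an idempotent is its own inverse.
      refine IsUnit.of_mul_eq_one (2 * q e₀ - 1) ?_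
      have hd : (Polynomial.X ^ 2 - Polynomial.X : Polynomial S).derivative.eval e₀ =
          2 * e₀ - 1 := by simp [one_add_one_eq_two]
      rw [hd, map_sub, map_mul, map_ofNat, map_one]
      linear_combination 4 * hid)
  have hqe : q e = q x ^ n * y ^ n := by
    rw [← he₀]
    exact (Ideal.Quotient.eq).2 hee
  have he' : e * e = e := by
    have := he
    simp only [Polynomial.IsRoot, Polynomial.eval_sub, Polynomial.eval_pow,
      Polynomial.eval_X] at this
    linear_combination this
  -- Modulo `J`, `e = 0` makes `x` nilpotent and `e = 1` makes it a unit; units lift because `J`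
  -- lies in the Jacobson radical.
  rcases hS e he' with rfl | rfl
  · right
    have hz : q x ^ n = 0 := by
      rw [← hk n, pow_add, mul_assoc, ← hqe, map_zero, mul_zero]
    refine isUnit_of_map_unit q _ ?_
    rw [map_sub, map_one]
    exact IsNilpotent.isUnit_one_sub ⟨n, hz⟩
  · left
    refine isUnit_of_map_unit q _ ?_
    rw [map_one] at hqe
    exact (isUnit_pow_iff hn).1 (IsUnit.of_mul_eq_one _ hqe.symm)

/-- The endomorphism ring of an indecomposable module which is finite over a complete Noetherian
local ring is local. -/
theorem isUnit_or_isUnit_one_sub_end {O A M : Type*} [CommRing O] [IsNoetherianRing O]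
    [IsLocalRing O] [IsAdicComplete (IsLocalRing.maximalIdeal O) O] [Ring A] [Algebra O A]
    [AddCommGroup M] [Module O M] [Module A M] [IsScalarTower O A M] [Module.Finite O M]
    (hM : ∀ e : Module.End A M, e * e = e → e = 0 ∨ e = 1) (b : Module.End A M) :
    IsUnit b ∨ IsUnit (1 - b) := by
  have : Module.Finite O (Module.End A M) := by
    let ι : Module.End A M →ₗ[O] Module.End O M :=
      { toFun := fun f => f.restrictScalars O
        map_add' := fun _ _ => rfl
        map_smul' := fun _ _ => rfl }
    exact Module.Finite.of_injective ι fun f g h => LinearMap.ext fun x => LinearMap.congr_fun h x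
  -- The commutative case applies to `O[b]`, whose idempotents are idempotents of `End(M)`.
  let S := Algebra.adjoin O {b}
  have := Algebra.isMulCommutative_adjoin O (s := {b}) (by simp)
  have : Module.Finite O S := Module.Finite.of_injective S.val.toLinearMap Subtype.val_injective
  have key := isUnit_or_isUnit_one_sub_of_finite (R := O) (S := S)
    (fun e he => by
      have := hM e.1 (congrArg Subtype.val he)
      exact this.imp Subtype.ext Subtype.ext)
    ⟨b, Algebra.self_mem_adjoin_singleton O b⟩
  exact key.imp (fun h => h.map S.val) (fun h => h.map S.val)

theorem IsIndecomposable.eq_zero_or_one {A M : Type*} [Ring A] [AddCommGroup M] [Module A M]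
    (h : IsIndecomposable A M) (e : Module.End A M) (he : e * e = e) : e = 0 ∨ e = 1 := by
  have hc := LinearMap.IsIdempotentElem.isCompl (f := e) he
  rcases h.2 _ _ hc with h | h
  · left; exact LinearMap.range_eq_bot.1 h
  · right
    refine LinearMap.ext fun x => LinearMap.ker_eq_bot.1 h ?_
    exact LinearMap.congr_fun he x

end LocalEndomorphismRing

/-! ### Dual bases up to a scalar -/

section GenericProjectivity

variable {O K : Type*} [CommRing O] [Field K] [Algebra O K]

theorem tmul_one_injective [IsDomain O] [IsFractionRing O K] {N : Type*} [AddCommGroup N]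
    [Module O N] [Module.Flat O N] : Function.Injective fun x : N => x ⊗ₜ[O] (1 : K) := by
  have h := Module.Flat.lTensor_preserves_injective_linearMap (M := N) (Algebra.linearMap O K)
    (IsFractionRing.injective O K)
  have h' := h.comp (TensorProduct.rid O N).symm.injective
  convert h' using 2 with x
  simp

theorem exists_smul_eq_tmul_one [IsDomain O] [IsFractionRing O K] {N : Type*} [AddCommGroup N]
    [Module O N] (z : N ⊗[O] K) : ∃ r : O, r ≠ 0 ∧ ∃ y : N, r • z = y ⊗ₜ 1 := by
  induction z with
  | zero => exact ⟨1, one_ne_zero, 0, by simp⟩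
  | tmul x d =>
    obtain ⟨a, b, hb, rfl⟩ := IsFractionRing.div_surjective (A := O) d
    refine ⟨b, nonZeroDivisors.ne_zero hb, a • x, ?_⟩
    have : algebraMap O K b ≠ 0 := by
      simpa using nonZeroDivisors.ne_zero hb
    rw [← TensorProduct.tmul_smul, TensorProduct.smul_tmul, Algebra.smul_def, Algebra.smul_def,
      mul_div_cancel₀ _ this, mul_one]
  | add z w hz hw =>
    obtain ⟨r, hr, y, hy⟩ := hz
    obtain ⟨s, hs, x, hx⟩ := hw
    refine ⟨r * s, mul_ne_zero hr hs, s • y + r • x, ?_⟩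
    rw [smul_add, TensorProduct.add_tmul, ← TensorProduct.smul_tmul', ← TensorProduct.smul_tmul',
      ← hy, ← hx, smul_smul, smul_smul, mul_comm s r]

theorem exists_smul_eq_tmul_one_family [IsDomain O] [IsFractionRing O K] {N ι : Type*}
    [Finite ι] [AddCommGroup N] [Module O N] (z : ι → N ⊗[O] K) :
    ∃ r : O, r ≠ 0 ∧ ∀ i, ∃ y : N, r • z i = y ⊗ₜ 1 := by
  have := Fintype.ofFinite ι
  choose r hr y hy using fun i => exists_smul_eq_tmul_one (z i)
  refine ⟨∏ i, r i, Finset.prod_ne_zero_iff.2 fun i _ => hr i, fun i => ?_⟩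
  obtain ⟨c, hc⟩ := Finset.dvd_prod_of_mem r (Finset.mem_univ i)
  exact ⟨c • y i, by rw [hc, mul_comm, mul_smul, hy, TensorProduct.smul_tmul']⟩

/-- A generically projective lattice has a dual basis up to a nonzero scalar. -/
theorem IsGenericallyProjective.exists_dual_basis [IsDomain O] [IsFractionRing O K]
    {A M : Type*} [Ring A] [Algebra O A] [AddCommGroup M] [Module O M] [Module A M]
    [IsScalarTower O A M] [Module.Flat O A] [Module.Flat O M] [Module.Finite O M]
    (h : IsGenericallyProjective O K A M) :
    ∃ r : O, r ≠ 0 ∧ ∃ (n : ℕ) (l : Fin n → M →ₗ[A] A) (x : Fin n → M),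
      ∀ m, ∑ i, l i m • x i = r • m := by
  let inst : Module (A ⊗[O] K) (M ⊗[O] K) := scalarExtensionModule O K A M
  have hproj : Module.Projective (A ⊗[O] K) (M ⊗[O] K) := h
  have smul_tmul (a : A) (c : K) (m : M) (d : K) :
      (a ⊗ₜ[O] c) • (m ⊗ₜ[O] d) = (a • m) ⊗ₜ[O] (c * d) := rfl
  have smul_smul' (r : O) (z : A ⊗[O] K) (w : M ⊗[O] K) : (r • z) • w = r • (z • w) :=
    congrArg (fun f : Module.End O (M ⊗[O] K) => f w)
      (map_smul (scalarExtensionAction O K A M) r z)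
  obtain ⟨n, x, hx⟩ := Module.Finite.exists_fin (R := O) (M := M)
  let π := Fintype.linearCombination (A ⊗[O] K) fun i => x i ⊗ₜ[O] (1 : K)
  have hπ (c) : π c = ∑ i, c i • (x i ⊗ₜ[O] (1 : K)) := Fintype.linearCombination_apply ..
  have hsurj : Function.Surjective π := by
    intro z
    induction z with
    | zero => exact ⟨0, map_zero _⟩
    | add z w hz hw =>
      obtain ⟨a, rfl⟩ := hz
      obtain ⟨b, rfl⟩ := hw
      exact ⟨a + b, map_add _ _ _⟩
    | tmul m d =>
      obtain ⟨c, rfl⟩ := (Submodule.mem_span_range_iff_exists_fun O).1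
        (hx ▸ Submodule.mem_top : m ∈ Submodule.span O (Set.range x))
      refine ⟨fun i => algebraMap O A (c i) ⊗ₜ d, ?_⟩
      simp only [hπ, smul_tmul, TensorProduct.sum_tmul, mul_one, algebraMap_smul]
  obtain ⟨s, hs⟩ := π.exists_rightInverse_of_surjective (LinearMap.range_eq_top.2 hsurj)
  -- One common denominator for the coordinates of the section `s` on the finitely many generators;
  -- by linearity it serves all of `M`.
  obtain ⟨r, hr, hy⟩ := exists_smul_eq_tmul_one_family
    fun ij : Fin n × Fin n => s (x ij.1 ⊗ₜ[O] (1 : K)) ij.2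
  have hsmul (a : A) (m : M) (i) :
      s ((a • m) ⊗ₜ[O] (1 : K)) i = (a ⊗ₜ[O] (1 : K)) * s (m ⊗ₜ[O] (1 : K)) i := by
    rw [← smul_eq_mul, ← Pi.smul_apply, ← map_smul, smul_tmul, mul_one]
  have hadd (m m' : M) (i) : s ((m + m') ⊗ₜ[O] (1 : K)) i =
      s (m ⊗ₜ[O] (1 : K)) i + s (m' ⊗ₜ[O] (1 : K)) i := by
    rw [TensorProduct.add_tmul, map_add, Pi.add_apply]
  have hint (m : M) (i) : ∃ a : A, r • s (m ⊗ₜ[O] (1 : K)) i = a ⊗ₜ 1 := by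
    have hm : m ∈ Submodule.span O (Set.range x) := hx ▸ Submodule.mem_top
    induction hm using Submodule.span_induction with
    | mem m hm =>
      obtain ⟨j, rfl⟩ := hm
      exact hy (j, i)
    | zero => exact ⟨0, by simp⟩
    | add m m' _ _ h h' =>
      obtain ⟨a, ha⟩ := h
      obtain ⟨b, hb⟩ := h'
      exact ⟨a + b, by rw [hadd, smul_add, ha, hb, TensorProduct.add_tmul]⟩
    | smul c m _ h =>
      obtain ⟨a, ha⟩ := h
      refine ⟨algebraMap O A c * a, ?_⟩
      rw [← algebraMap_smul A c m, hsmul, ← mul_smul_comm, ha,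
        Algebra.TensorProduct.tmul_mul_tmul, mul_one]
  choose l hl using hint
  -- The chosen values are unique because `A → A ⊗ K` is injective, so they depend `A`-linearly on
  -- `m`.
  refine ⟨r, hr, n, fun i =>
    { toFun := fun m => l m i
      map_add' := fun m m' => tmul_one_injective (O := O) (K := K) ?_
      map_smul' := fun a m => tmul_one_injective (O := O) (K := K) ?_ }, x, fun m =>
      tmul_one_injective (O := O) (K := K) ?_⟩
  · change l (m + m') i ⊗ₜ[O] (1 : K) = (l m i + l m' i) ⊗ₜ[O] (1 : K)
    rw [TensorProduct.add_tmul, ← hl (m + m'), ← hl m, ← hl m', hadd, smul_add]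
  · simp only [RingHom.id_apply, smul_eq_mul]
    rw [← hl, hsmul, ← mul_smul_comm, hl, Algebra.TensorProduct.tmul_mul_tmul, mul_one]
  · have hsm : ∑ i, s (m ⊗ₜ[O] (1 : K)) i • (x i ⊗ₜ[O] (1 : K)) = m ⊗ₜ 1 := by
      rw [← hπ]
      exact LinearMap.congr_fun hs _
    change (∑ i, l m i • x i) ⊗ₜ[O] (1 : K) = (r • m) ⊗ₜ[O] (1 : K)
    rw [TensorProduct.sum_tmul, ← TensorProduct.smul_tmul', ← hsm, Finset.smul_sum]
    refine Finset.sum_congr rfl fun i _ => ?_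
    rw [← smul_smul', hl, smul_tmul, mul_one]

end GenericProjectivity

/-! ### Extending linear forms along a surjection -/

section Extension

/-- The cokernel is finite and torsion-free over a PID, hence free, so the image of `j` is a direct
summand. -/
theorem exists_extension_of_torsionFree_cokernel {R N N' : Type*} [CommRing R] [IsDomain R]
    [IsPrincipalIdealRing R] [AddCommGroup N] [Module R N] [AddCommGroup N'] [Module R N']
    [Module.Finite R N'] (j : N →ₗ[R] N') (hj : Function.Injective j)
    (hc : ∀ (r : R) (y : N'), r ≠ 0 → r • y ∈ LinearMap.range j → y ∈ LinearMap.range j)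
    {F : Type*} [AddCommGroup F] [Module R F] (τ : N →ₗ[R] F) : ∃ σ : N' →ₗ[R] F, σ ∘ₗ j = τ := by
  let C := N' ⧸ LinearMap.range j
  have : Module.IsTorsionFree R C := by
    rw [Module.isTorsionFree_iff_smul_eq_zero]
    intro r y h
    induction y using Submodule.Quotient.induction_on with
    | H y =>
      by_contra! hne
      rw [← Submodule.Quotient.mk_smul, Submodule.Quotient.mk_eq_zero] at h
      exact hne.2 ((Submodule.Quotient.mk_eq_zero _).2 (hc r y hne.1 h))
  obtain ⟨s, hs⟩ := (LinearMap.range j).mkQ.exists_rightInverse_of_surjective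
    (Submodule.range_mkQ _)
  let ρ : N' →ₗ[R] N' := LinearMap.id - s ∘ₗ (LinearMap.range j).mkQ
  have hmem (y : N') : ρ y ∈ LinearMap.range j := by
    rw [← Submodule.Quotient.mk_eq_zero, ← Submodule.mkQ_apply]
    have := LinearMap.congr_fun hs ((LinearMap.range j).mkQ y)
    simp only [LinearMap.comp_apply, LinearMap.id_apply] at this
    simp only [ρ, LinearMap.sub_apply, LinearMap.comp_apply, LinearMap.id_apply, map_sub, this,
      sub_self]
  refine ⟨τ ∘ₗ (LinearEquiv.ofInjective j hj).symm.toLinearMap ∘ₗ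
    LinearMap.codRestrict _ ρ hmem, LinearMap.ext fun n => ?_⟩
  simp only [LinearMap.comp_apply, LinearEquiv.coe_coe]
  congr 1
  rw [LinearEquiv.symm_apply_eq]
  ext
  have : (LinearMap.range j).mkQ (j n) = 0 := (Submodule.Quotient.mk_eq_zero _).2 ⟨n, rfl⟩
  simp [ρ, this]

variable {O A : Type*} [CommRing O] [Ring A] [Algebra O A]
  {P M X : Type*} [AddCommGroup P] [Module A P] [AddCommGroup M] [Module A M]
  [AddCommGroup X] [Module O X] [Module A X] [IsScalarTower O A X]

theorem finite_hom [IsNoetherianRing O] [Module.Finite A P] [Module.Finite O X] :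
    Module.Finite O (P →ₗ[A] X) := by
  obtain ⟨n, e, he⟩ := Module.Finite.exists_fin (R := A) (M := P)
  let ι : (P →ₗ[A] X) →ₗ[O] Fin n → X :=
    { toFun := fun f i => f (e i)
      map_add' := fun _ _ => rfl
      map_smul' := fun _ _ => rfl }
  refine Module.Finite.of_injective ι fun f g h => LinearMap.ext_on_range he fun i => ?_
  exact congrFun h i

/-- Lifts of generators of `M` span `P` modulo the superfluous kernel, hence span `P`. -/
theorem IsProjectiveCover.finite {p : P →ₗ[A] M} (hp : IsProjectiveCover p) [Module.Finite A M] :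
    Module.Finite A P := by
  obtain ⟨n, m, hm⟩ := Module.Finite.exists_fin (R := A) (M := M)
  choose e he using fun i => hp.surjective (m i)
  have htop : Submodule.span A (Set.range e) = ⊤ := by
    refine hp.superfluous _ (top_unique fun y _ => ?_)
    have hy : p y ∈ (Submodule.span A (Set.range e)).map p := by
      rw [Submodule.map_span, ← Set.range_comp, (funext he : p ∘ e = m), hm]
      trivial
    obtain ⟨z, hz, hzy⟩ := hy
    refine Submodule.mem_sup.2 ⟨z, hz, y - z, ?_, add_sub_cancel z y⟩
    rw [LinearMap.mem_ker, map_sub, hzy, sub_self]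
  exact ⟨htop ▸ Submodule.fg_span (Set.finite_range e)⟩

/-- Linear forms on `Hom(M, X)` extend along a surjection `P → M`. -/
theorem exists_hom_extension [IsDomain O] [IsPrincipalIdealRing O] [Module.Finite A P]
    [Module.Finite O X] [Module.IsTorsionFree O X] {p : P →ₗ[A] M} (hp : Function.Surjective p)
    (τ : (M →ₗ[A] X) →ₗ[O] O) :
    ∃ σ : (P →ₗ[A] X) →ₗ[O] O, ∀ g : M →ₗ[A] X, σ (g ∘ₗ p) = τ g := by
  have : Module.Finite O (P →ₗ[A] X) := finite_hom
  let j : (M →ₗ[A] X) →ₗ[O] (P →ₗ[A] X) :=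
    { toFun := fun g => g ∘ₗ p
      map_add' := fun _ _ => rfl
      map_smul' := fun _ _ => rfl }
  obtain ⟨σ, hσ⟩ := exists_extension_of_torsionFree_cokernel j
    (fun f g h => LinearMap.cancel_right hp |>.1 h) (fun r h hr ⟨g, hg⟩ => by
      -- The cokernel is torsion-free: if `r • h` kills `ker p`, so does `h`, which then descends to
      -- `M`.
      have hker : LinearMap.ker p ≤ LinearMap.ker h := by
        intro y hy
        have : r • h y = 0 := by
          rw [← LinearMap.smul_apply, ← hg]
          change g (p y) = 0
          rw [LinearMap.mem_ker.1 hy, map_zero]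
        exact (smul_eq_zero.1 this).resolve_left hr
      refine ⟨(LinearMap.ker p).liftQ h hker ∘ₗ
        (p.quotKerEquivOfSurjective hp).symm.toLinearMap, LinearMap.ext fun y => ?_⟩
      change (LinearMap.ker p).liftQ h hker ((p.quotKerEquivOfSurjective hp).symm (p y)) = h y
      have : (p.quotKerEquivOfSurjective hp).symm (p y) = (LinearMap.ker p).mkQ y := by
        rw [LinearEquiv.symm_apply_eq]; rfl
      rw [this]
      simp) τ
  exact ⟨σ, fun g => LinearMap.congr_fun hσ g⟩

end Extension

/-! ### Finiteness and torsion-freeness of duals -/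

section DualForms

variable {O : Type*} [CommRing O] {N : Type*} [AddCommGroup N] [Module O N]

instance : LinearMapClass (LatticeDual O N) O N O :=
  inferInstanceAs (LinearMapClass (N →ₗ[O] O) O N O)

theorem LatticeDual.ext {f g : LatticeDual O N} (h : ∀ n, f n = g n) : f = g :=
  LinearMap.ext h

theorem LatticeDual.sum_apply {ι : Type*} (s : Finset ι) (f : ι → LatticeDual O N) (n : N) :
    (∑ i ∈ s, f i) n = ∑ i ∈ s, f i n :=
  LinearMap.sum_apply s f n

theorem isLattice_of_finite_of_torsionFree {A X : Type*} [IsDomain O] [IsPrincipalIdealRing O]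
    [Ring A] [Algebra O A] [AddCommGroup X] [Module O X] [Module A X] [IsScalarTower O A X]
    [Module.Finite O X] [Module.IsTorsionFree O X] : IsLattice O A X :=
  ⟨inferInstance, inferInstance⟩

theorem finite_latticeDual [IsNoetherianRing O] [Module.Finite O N] :
    Module.Finite O (LatticeDual O N) :=
  finite_hom (O := O) (A := O) (P := N) (X := O)

theorem isTorsionFree_latticeDual [IsDomain O] : Module.IsTorsionFree O (LatticeDual O N) :=
  inferInstanceAs (Module.IsTorsionFree O (N →ₗ[O] O))

end DualForms

/-! ### Radical homomorphisms -/

section RadicalHoms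

variable {O A : Type u} [CommRing O] [Ring A] [Algebra O A]
  {M N E : Type u} [AddCommGroup M] [Module A M] [AddCommGroup N] [Module A N]
  [AddCommGroup E] [Module A E]

theorem mem_jacobson_iff_exists_mul_add_one {R : Type*} [Ring R] {x : R} :
    x ∈ Ring.jacobson R ↔ ∀ y, ∃ z, z * (y * x + 1) = 1 := by
  rw [← Ideal.jacobson_bot, Ideal.mem_jacobson_iff]
  simp only [Ideal.mem_bot, sub_eq_zero, mul_add, mul_assoc, mul_one]

/-- If every endomorphism of `N` factoring through `f : M → N` is radical, then `f` is radical. -/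
theorem isRadicalHom_of_comp_mem_jacobson {f : M →ₗ[A] N}
    (h : ∀ w : N →ₗ[A] M, f ∘ₗ w ∈ Ring.jacobson (Module.End A N)) : IsRadicalHom O f := by
  intro X _ _ _ _ _ _ a b
  rw [mem_jacobson_iff_exists_mul_add_one]
  intro y
  obtain ⟨z, hz⟩ := mem_jacobson_iff_exists_mul_add_one.1 (h (a ∘ₗ y ∘ₗ b)) 1
  -- If `z` is a left inverse of `1 + uv`, then `1 - v z u` is one of `1 + vu`; here `u = f a` and
  -- `v = y b`.
  refine ⟨1 - y ∘ₗ b ∘ₗ z ∘ₗ f ∘ₗ a, LinearMap.ext fun t => ?_⟩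
  have := LinearMap.congr_fun hz (f (a t))
  simp only [Module.End.mul_apply, LinearMap.add_apply, LinearMap.comp_apply, one_mul,
    Module.End.one_apply] at this
  simp [this]

theorem isRadicalHom_of_mem_jacobson {f : Module.End A M}
    (hf : f ∈ Ring.jacobson (Module.End A M)) : IsRadicalHom O f :=
  isRadicalHom_of_comp_mem_jacobson fun w => Ideal.mul_mem_right w _ hf

/-- Were `1 + y q w` not invertible, locality would make `y q w` a unit and give `q w` a left
inverse `d`. The idempotent `(q w) d` is then nonzero, hence `1`, and `w d` splits `q`. -/
theorem comp_mem_jacobson_of_not_split [IsNoetherianRing O]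
    [IsLocalRing O] [IsAdicComplete (IsLocalRing.maximalIdeal O) O]
    [Module O M] [IsScalarTower O A M] [Module.Finite O M] (hM : IsIndecomposable A M)
    {q : E →ₗ[A] M} (hq : ¬ ∃ s : M →ₗ[A] E, q ∘ₗ s = LinearMap.id) (w : M →ₗ[A] E) :
    q ∘ₗ w ∈ Ring.jacobson (Module.End A M) := by
  have := hM.1
  rw [mem_jacobson_iff_exists_mul_add_one]
  intro y
  rcases isUnit_or_isUnit_one_sub_end (O := O) hM.eq_zero_or_one (-(y * (q ∘ₗ w))) with h | h
  · exfalso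
    obtain ⟨v, hv⟩ := h.exists_left_inv
    set c : Module.End A M := q ∘ₗ w with hc
    set d : Module.End A M := -(v * y) with hd
    have hdc : d * c = 1 := by rw [hd, ← hv]; simp [mul_assoc]
    rcases hM.eq_zero_or_one (c * d) (by rw [mul_assoc, ← mul_assoc d, hdc, one_mul]) with h0 | h1
    · have : (1 : Module.End A M) = 0 := by
        calc (1 : Module.End A M) = d * c * (d * c) := by rw [hdc, one_mul]
          _ = d * (c * d) * c := by simp only [mul_assoc]
          _ = 0 := by rw [h0, mul_zero, zero_mul]
      exact one_ne_zero this
    · exact hq ⟨w ∘ₗ d, h1⟩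
  · rw [sub_neg_eq_add, add_comm] at h
    exact h.exists_left_inv

end RadicalHoms

/-! ### The trace criterion for factoring through `ν(p)` -/

section Factorization

variable {O A : Type*} [CommRing O] [Ring A] [Algebra O A]
  {P M X : Type*} [AddCommGroup P] [Module A P] [AddCommGroup M] [Module A M]
  [AddCommGroup X] [Module O X] [Module A X] [IsScalarTower O A X]

theorem nakayamaMap_apply (p : P →ₗ[A] M) (f : Nakayama O A P) (g : M →ₗ[A] A) :
    nakayamaMap O A p f g = f (g ∘ₗ p) := rfl

theorem nakayama_smul_apply (a : A) (f : Nakayama O A M) (g : M →ₗ[A] A) :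
    (a • f) g = f (MulOpposite.op a • g) := rfl

theorem nakayamaMap_surjective [IsDomain O] [IsPrincipalIdealRing O] [Module.Finite A P]
    [Module.Finite O A] [Module.IsTorsionFree O A] {p : P →ₗ[A] M} (hp : Function.Surjective p) :
    Function.Surjective (nakayamaMap O A p) := fun f => by
  obtain ⟨σ, hσ⟩ := exists_hom_extension hp (f : (M →ₗ[A] A) →ₗ[O] O)
  exact ⟨σ, LatticeDual.ext hσ⟩

theorem translateIncl_injective (p : P →ₗ[A] M) :
    Function.Injective (translateIncl O A p) := fun f g h =>
  LatticeDual.ext fun n => by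
    obtain ⟨n, rfl⟩ := Submodule.Quotient.mk_surjective _ n
    exact LinearMap.congr_fun h n

theorem exact_translateIncl_nakayamaMap (p : P →ₗ[A] M) :
    Function.Exact (translateIncl O A p) (nakayamaMap O A p) := fun f => by
  refine ⟨fun h => ?_, ?_⟩
  · have hle : LinearMap.range ((homMap A p).restrictScalars O) ≤
        LinearMap.ker (f : (P →ₗ[A] A) →ₗ[O] O) := by
      rintro _ ⟨g, rfl⟩
      exact LinearMap.congr_fun h g
    refine ⟨((LinearMap.range ((homMap A p).restrictScalars O)).liftQ _ hle : _), ?_⟩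
    exact LatticeDual.ext fun g => rfl
  · rintro ⟨l, rfl⟩
    exact nakayamaMap_translateIncl O A p l

/-- If `θ : M → ν M` factors through `ν(p)` with `P` projective, then the trace form of `θ` takes
an integral value at the identity. -/
theorem dvd_trace_of_factors [Module O M] [IsScalarTower O A M]
    [Module.Projective A P] [Module.Finite A P] (p : P →ₗ[A] M)
    {r : O} {n : ℕ} {l : Fin n → M →ₗ[A] A} {x : Fin n → M}
    (hl : ∀ m, ∑ i, l i m • x i = r • m) (ψ : M →ₗ[A] Nakayama O A P) :
    r ∣ ∑ i, (nakayamaMap O A p ∘ₗ ψ) (x i) (l i) := by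
  obtain ⟨k, π, hπ⟩ := Module.Finite.exists_fin' A P
  obtain ⟨s, hs⟩ := π.exists_rightInverse_of_surjective (LinearMap.range_eq_top.2 hπ)
  let e (j : Fin k) : P := π (Pi.single j 1)
  let μ (j : Fin k) : P →ₗ[A] A := LinearMap.proj j ∘ₗ s
  -- `e` and `μ` form a dual basis of `P`, a direct summand of `A^k`.
  have he (y : P) : ∑ j, μ j y • e j = y := by
    conv_rhs => rw [← LinearMap.id_apply (R := A) y, ← hs, LinearMap.comp_apply,
      pi_eq_sum_univ' (s y), map_sum]
    refine Finset.sum_congr rfl fun j _ => ?_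
    rw [map_smul]
    rfl
  have hμ (i : Fin n) : l i ∘ₗ p = ∑ j, MulOpposite.op (l i (p (e j))) • μ j := by
    ext y
    conv_lhs => rw [← he y]
    simp [map_sum]
  -- The quotient is the trace of `ψ p` in the dual basis of `P`: expand `l i ∘ p` in the `μ j` and
  -- move the coefficients onto `x i`, where the sum over `i` gives `r • p (e j)`.
  refine ⟨∑ j, ψ (p (e j)) (μ j), ?_⟩
  calc ∑ i, (nakayamaMap O A p ∘ₗ ψ) (x i) (l i)
      = ∑ i, ∑ j, ψ (l i (p (e j)) • x i) (μ j) := by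
        refine Finset.sum_congr rfl fun i _ => ?_
        rw [LinearMap.comp_apply, nakayamaMap_apply, hμ, map_sum]
        refine Finset.sum_congr rfl fun j _ => ?_
        rw [ψ.map_smul, nakayama_smul_apply]
    _ = ∑ j, ψ (∑ i, l i (p (e j)) • x i) (μ j) := by
        rw [Finset.sum_comm]
        refine Finset.sum_congr rfl fun j _ => ?_
        rw [map_sum, LatticeDual.sum_apply]
    _ = r * ∑ j, ψ (p (e j)) (μ j) := by
        rw [Finset.mul_sum]
        refine Finset.sum_congr rfl fun j _ => ?_
        rw [hl, ← algebraMap_smul A r, map_smul, algebraMap_smul]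
        rfl

/-- If the trace form of `θ : X → ν M` is integral, then `θ` factors through `ν(p)`. -/
theorem exists_factorization_of_dvd_trace [IsDomain O] [IsPrincipalIdealRing O]
    [Module O M] [IsScalarTower O A M] [Module.Finite A P]
    [Module.Finite O X] [Module.IsTorsionFree O X] {p : P →ₗ[A] M} (hp : Function.Surjective p)
    {r : O} (hr : r ≠ 0) {n : ℕ} {l : Fin n → M →ₗ[A] A} {x : Fin n → M}
    (hl : ∀ m, ∑ i, l i m • x i = r • m) (θ : X →ₗ[A] Nakayama O A M)
    (hθ : ∀ g : M →ₗ[A] X, r ∣ ∑ i, θ (g (x i)) (l i)) :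
    ∃ ψ : X →ₗ[A] Nakayama O A P, nakayamaMap O A p ∘ₗ ψ = θ := by
  choose t ht using hθ
  have hθO (c : O) (y : X) (f : M →ₗ[A] A) : θ (c • y) f = c * θ y f := by
    rw [← algebraMap_smul A c, map_smul, algebraMap_smul]
    rfl
  -- Division by `r ≠ 0` is unique in the domain `O`, so the divided trace is linear in `g`.
  let τ : (M →ₗ[A] X) →ₗ[O] O :=
    { toFun := t
      map_add' := fun f g => mul_left_cancel₀ hr <| by
        rw [mul_add, ← ht, ← ht, ← ht, ← Finset.sum_add_distrib]
        refine Finset.sum_congr rfl fun i _ => ?_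
        rw [LinearMap.add_apply, map_add]
        rfl
      map_smul' := fun c g => mul_left_cancel₀ hr <| by
        rw [RingHom.id_apply, smul_eq_mul, mul_left_comm, ← ht, ← ht, Finset.mul_sum]
        exact Finset.sum_congr rfl fun i _ => hθO ..}
  obtain ⟨σ, hσ⟩ := exists_hom_extension hp τ
  -- A form `σ` on `Hom(P, X)` yields `X → ν P` by evaluating `σ` on the rank-one maps `z ↦ μ z •
  -- y`.
  let ψ : X →ₗ[A] Nakayama O A P :=
    { toFun := fun y => (show (P →ₗ[A] A) →ₗ[O] O from
        { toFun := fun μ => σ (LinearMap.toSpanSingleton A X y ∘ₗ μ)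
          map_add' := fun μ μ' => by rw [LinearMap.comp_add, map_add]
          map_smul' := fun c μ => by
            rw [RingHom.id_apply, ← map_smul]
            congr 1
            ext z
            simp })
      map_add' := fun y y' => LatticeDual.ext fun μ => by
        refine Eq.trans ?_ (map_add σ _ _)
        change σ _ = σ _
        congr 1
        ext z
        simp
      map_smul' := fun a y => LatticeDual.ext fun μ => by
        change σ _ = σ _
        congr 1
        ext z
        exact (mul_smul (μ z) a y).symm }
  refine ⟨ψ, LinearMap.ext fun y => LatticeDual.ext fun f => mul_left_cancel₀ hr ?_⟩
  -- The same data, read on the right module `Hom(M, A)`, form a dual basis up to `r`.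
  have hsum : ∑ i, MulOpposite.op (f (x i)) • l i = r • f := by
    ext m
    have := congrArg f (hl m)
    rw [← algebraMap_smul A r m, map_smul, algebraMap_smul] at this
    rw [LinearMap.smul_apply, ← this]
    simp [map_sum]
  calc r * (nakayamaMap O A p ∘ₗ ψ) y f
      = r * σ ((LinearMap.toSpanSingleton A X y ∘ₗ f) ∘ₗ p) := rfl
    _ = r * t (LinearMap.toSpanSingleton A X y ∘ₗ f) := by rw [hσ]; rfl
    _ = ∑ i, θ (f (x i) • y) (l i) := (ht _).symm
    _ = ∑ i, θ y (MulOpposite.op (f (x i)) • l i) := by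
        refine Finset.sum_congr rfl fun i _ => ?_
        rw [map_smul, nakayama_smul_apply]
    _ = r * θ y f := by rw [← map_sum, hsum, map_smul, smul_eq_mul]

end Factorization

/-! ### The pullback sequence -/

section Pullback

variable {O A : Type*} [CommRing O] [Ring A] [Algebra O A]
  {P M X : Type*} [AddCommGroup P] [Module A P] [AddCommGroup M] [Module A M]
  [AddCommGroup X] [Module A X]

theorem exists_lift_pullback_iff (p : P →ₗ[A] M) (φ : M →ₗ[A] Nakayama O A M) (f : X →ₗ[A] M) :
    (∃ g : X →ₗ[A] pullback O p φ, pullbackProj O p φ ∘ₗ g = f) ↔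
      ∃ ψ : X →ₗ[A] Nakayama O A P, nakayamaMap O A p ∘ₗ ψ = φ ∘ₗ f := by
  constructor
  · rintro ⟨g, rfl⟩
    exact ⟨LinearMap.fst A _ M ∘ₗ (pullback O p φ).subtype ∘ₗ g, LinearMap.ext fun y => (g y).2⟩
  · rintro ⟨ψ, hψ⟩
    exact ⟨(ψ.prod f).codRestrict (pullback O p φ) fun y => LinearMap.congr_fun hψ y,
      LinearMap.ext fun _ => rfl⟩

theorem pullbackIncl_injective (p : P →ₗ[A] M) (φ : M →ₗ[A] Nakayama O A M) :
    Function.Injective (pullbackIncl O p φ) := fun _ _ h =>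
  translateIncl_injective p (congrArg (fun z => z.1.1) h)

theorem exact_pullbackIncl_pullbackProj (p : P →ₗ[A] M) (φ : M →ₗ[A] Nakayama O A M) :
    Function.Exact (pullbackIncl O p φ) (pullbackProj O p φ) := by
  rintro ⟨⟨y, m⟩, h⟩
  constructor
  · rintro (rfl : m = 0)
    obtain ⟨z, rfl⟩ := (exact_translateIncl_nakayamaMap p y).1 (Eq.trans h φ.map_zero)
    exact ⟨z, rfl⟩
  · rintro ⟨z, hz⟩
    exact (congrArg (fun w => w.1.2) hz).symm

theorem pullbackProj_surjective {p : P →ₗ[A] M} (hp : Function.Surjective (nakayamaMap O A p))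
    (φ : M →ₗ[A] Nakayama O A M) : Function.Surjective (pullbackProj O p φ) := fun m => by
  obtain ⟨y, hy⟩ := hp (φ m)
  exact ⟨⟨(y, m), hy⟩, rfl⟩

theorem isLattice_pullback [IsDomain O] [IsPrincipalIdealRing O] [Module.Finite O A]
    [Module O M] [IsScalarTower O A M] [Module.Finite O M] [Module.IsTorsionFree O M]
    [Module.Finite A P] (p : P →ₗ[A] M) (φ : M →ₗ[A] Nakayama O A M) :
    IsLattice O A (pullback O p φ) := by
  have : Module.Finite O (P →ₗ[A] A) := finite_hom
  have : Module.Finite O (Nakayama O A P) := finite_latticeDual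
  have : Module.IsTorsionFree O (Nakayama O A P) := isTorsionFree_latticeDual
  let ι : pullback O p φ →ₗ[O] Nakayama O A P × M := (pullback O p φ).subtype.restrictScalars O
  have hι : Function.Injective ι := Subtype.val_injective
  have : Module.Finite O (pullback O p φ) := Module.Finite.of_injective ι hι
  have : Module.IsTorsionFree O (pullback O p φ) :=
    hι.moduleIsTorsionFree ι fun c x => map_smul ι c x
  exact isLattice_of_finite_of_torsionFree

end Pullback
end LatticeAR

theorem mainTheorem3 {O A M P : Type u} {K : Type v}
    [CommRing O] [IsDomain O] [IsDiscreteValuationRing O]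
    [IsAdicComplete (IsLocalRing.maximalIdeal O) O]
    [Field K] [Algebra O K] [IsFractionRing O K]
    [Ring A] [Algebra O A] (hA : LatticeAR.IsGorensteinOrder O A)
    [AddCommGroup M] [Module O M] [Module A M] [IsScalarTower O A M]
    (hM : LatticeAR.IsLattice O A M)
    (hM_indec : LatticeAR.IsIndecomposable A M)
    (hM_nonproj : ¬ Module.Projective A M)
    (hM_gen : LatticeAR.IsGenericallyProjective O K A M)
    [AddCommGroup P] [Module A P]
    (p : P →ₗ[A] M) (hp : LatticeAR.IsProjectiveCover p)
    (φ : M →ₗ[A] LatticeAR.Nakayama O A M) :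
    LatticeAR.IsAlmostSplit O (LatticeAR.pullbackIncl O p φ) (LatticeAR.pullbackProj O p φ) ↔
      (¬ ∃ ψ : M →ₗ[A] LatticeAR.Nakayama O A P, LatticeAR.nakayamaMap O A p ∘ₗ ψ = φ) ∧
      (LatticeAR.IsLattice O A (LatticeAR.Translate O A p) ∧
        LatticeAR.IsIndecomposable A (LatticeAR.Translate O A p)) ∧
      (∀ f : Module.End A M, f ∈ Ring.jacobson (Module.End A M) →
        ∃ ψ : M →ₗ[A] LatticeAR.Nakayama O A P,
          LatticeAR.nakayamaMap O A p ∘ₗ ψ = φ ∘ₗ f) := by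
  have := hA.finite
  have := hA.free
  have := hM.finite
  have := hM.free
  have : Module.Finite A M := Module.Finite.of_restrictScalars_finite O A M
  have : Module.Finite A P := hp.finite
  have := hp.projective
  obtain ⟨r, hr, n, l, x, hl⟩ := hM_gen.exists_dual_basis
  constructor
  · intro h
    refine ⟨fun ⟨ψ, hψ⟩ => h.not_split ?_, ⟨h.lattice_left, h.indecomposable_left⟩, fun f hf => ?_⟩
    · exact (LatticeAR.exists_lift_pullback_iff p φ LinearMap.id).2 ⟨ψ, hψ⟩
    · exact (LatticeAR.exists_lift_pullback_iff p φ f).1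
        ((h.range_eq_radical M hM hM_indec f).2 (LatticeAR.isRadicalHom_of_mem_jacobson hf))
  · rintro ⟨hφ, ⟨hL, hL'⟩, hrad⟩
    have hsplit : ¬ ∃ s, LatticeAR.pullbackProj O p φ ∘ₗ s = LinearMap.id := fun h =>
      hφ ((LatticeAR.exists_lift_pullback_iff p φ LinearMap.id).1 h)
    refine
      { lattice_left := hL
        lattice_middle := LatticeAR.isLattice_pullback p φ
        lattice_right := hM
        injective := LatticeAR.pullbackIncl_injective p φ
        exact := LatticeAR.exact_pullbackIncl_pullbackProj p φ
        surjective := LatticeAR.pullbackProj_surjective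
          (LatticeAR.nakayamaMap_surjective hp.surjective) φ
        not_split := hsplit
        indecomposable_left := hL'
        indecomposable_right := hM_indec
        range_eq_radical := fun X _ _ _ _ hX _ f => ⟨?_, fun hf => ?_⟩ }
    · rintro ⟨g, rfl⟩
      exact LatticeAR.isRadicalHom_of_comp_mem_jacobson fun w =>
        LatticeAR.comp_mem_jacobson_of_not_split (O := O) hM_indec hsplit (g ∘ₗ w)
    · have := hX.finite
      have := hX.free
      refine (LatticeAR.exists_lift_pullback_iff p φ f).2
        (LatticeAR.exists_factorization_of_dvd_trace hp.surjective hr hl (φ ∘ₗ f) fun g => ?_)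
      -- Testing radicality of `f` on `M` itself, with the identity on the left, puts `f g` in `Rad
      -- End(M)`.
      obtain ⟨ψ, hψ⟩ := hrad (f ∘ₗ g) (hf M hM hM_indec g LinearMap.id)
      have := LatticeAR.dvd_trace_of_factors p hl ψ
      rwa [hψ] at this
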